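/- Let $d\ge 1$ be an integer. A set $L\subseteq\mathbb R^d$ is called lattice-free if it is a $d$-dimensional closed convex set whose interior contains no point of $\mathbb Z^d$, and maximal lattice-free if moreover it is not properly contained in another lattice-free set. A rational polyhedron is the solution set in $\mathbb R^d$ of a finite system of linear inequalities with rational data. For a $d$-dimensional rational polyhedron $L\ne\mathbb R^d$ whose recession cone is a linear space, let $m(L)$ be the minimal positive integer $m$ such that $$L=\{x\in\mathbb R^d : b_i-m\le\langle a_i,x\rangle\le b_i\ \text{ for all } i=1,\dots,n\}$$ for some integer $n\ge 1$, some $a_1,\dots,a_n\in\mathbb Z^d\setminus\{0\}$ and some $b_1,\dots,b_n\in\mathbb Z$; if $L=\mathbb R^d$ or the recession cone of $L$ is not a linear space, let $m(L)=+\infty$. For a family $\mathcal L$ of $d$-dimensional rational polyhedra put $m(\mathcal L)=\sup_{L\in\mathcal L}m(L)$, with $m(\emptyset)=0$. Two sets $X,Y\subseteq\mathbb R^d$ are $\mathbb Z^d$-equivalent if $Y=U(X)+b$ for some unimodular matrix $U\in\mathbb Z^{d\times d}$ (that is, $\det U=\pm1$) and some $b\in\mathbb Z^d$; a family $\mathcal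 X$ of subsets of $\mathbb R^d$ is finite up to $\mathbb Z^d$-equivalence if there are finitely many sets $X_1,\dots,X_t\subseteq\mathbb R^d$ such that every $X\in\mathcal X$ is $\mathbb Z^d$-equivalent to some $X_i$. **Theorem.** Let $\mathcal L$ be a family of maximal lattice-free rational polyhedra in $\mathbb R^d$ such that $\dim(\operatorname{conv}(L\cap\mathbb Z^d))=d$ for every $L\in\mathcal L$. Then the following conditions are equivalent: (i) $m(\mathcal L)<+\infty$; (ii) $\mathcal L$ is finite up to $\mathbb Z^d$-equivalence. -/

import Mathlib

/-- The integer lattice `ℤ^d` as a subset of `ℝ^d`. -/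
def intLattice (d : ℕ) : Set (Fin d → ℝ) :=
  {x | ∀ j, ∃ z : ℤ, x j = (z : ℝ)}

/-- The standard scalar product `⟨a, x⟩` of an integer vector `a` and a real vector `x`. -/
def intInner {d : ℕ} (a : Fin d → ℤ) (x : Fin d → ℝ) : ℝ :=
  ∑ j, (a j : ℝ) * x j

/-- The (affine) dimension of a nonempty set `X ⊆ ℝ^d`: the dimension of its affine hull. -/
noncomputable def affineDim {d : ℕ} (X : Set (Fin d → ℝ)) : ℕ :=
  Module.finrank ℝ (affineSpan ℝ X).direction

/-- A rational polyhedron in `ℝ^d`: the solution set of finitely many linear inequalities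
with rational coefficients and rational right-hand sides. -/
def IsRationalPolyhedron {d : ℕ} (L : Set (Fin d → ℝ)) : Prop :=
  ∃ (n : ℕ) (a : Fin n → Fin d → ℚ) (b : Fin n → ℚ),
    L = {x | ∀ i, ∑ j, (a i j : ℝ) * x j ≤ (b i : ℝ)}

/-- A lattice-free set: a `d`-dimensional closed convex subset of `ℝ^d` whose interior
contains no integer point. -/
structure IsLatticeFree {d : ℕ} (L : Set (Fin d → ℝ)) : Prop where
  dim_eq : affineDim L = d
  isClosed : IsClosed L
  convex : Convex ℝ L
  interior_inter : interior L ∩ intLattice d = ∅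

/-- A maximal lattice-free set: a lattice-free set that is not properly contained in
another lattice-free set. -/
def IsMaximalLatticeFree {d : ℕ} (L : Set (Fin d → ℝ)) : Prop :=
  Maximal IsLatticeFree L

/-- The recession cone of `L`. -/
def recessionCone {d : ℕ} (L : Set (Fin d → ℝ)) : Set (Fin d → ℝ) :=
  {u | ∀ x ∈ L, ∀ t : ℝ, 0 ≤ t → x + t • u ∈ L}

/-- The recession cone of `L` is a linear space. -/
def HasLinearRecessionCone {d : ℕ} (L : Set (Fin d → ℝ)) : Prop :=
  ∃ S : Submodule ℝ (Fin d → ℝ), (S : Set (Fin d → ℝ)) = recessionCone L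

/-- `L = {x | b i - m ≤ ⟨a i, x⟩ ≤ b i for all i}` for some `n ≥ 1`, some nonzero integer
vectors `a 1, …, a n` and some integers `b 1, …, b n`. -/
def HasWidthRepresentation {d : ℕ} (L : Set (Fin d → ℝ)) (m : ℕ) : Prop :=
  ∃ (n : ℕ) (a : Fin n → Fin d → ℤ) (b : Fin n → ℤ),
    1 ≤ n ∧ (∀ i, a i ≠ 0) ∧
      L = {x | ∀ i, (b i : ℝ) - (m : ℝ) ≤ intInner (a i) x ∧ intInner (a i) x ≤ (b i : ℝ)}

open Classical in
/-- The max-facet-width `m(L)`: the least positive integer `m` for which `L` has a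
representation as above if `L ≠ ℝ^d` and the recession cone of `L` is a linear space,
and `+∞` otherwise. -/
noncomputable def maxFacetWidth {d : ℕ} (L : Set (Fin d → ℝ)) : ℕ∞ :=
  if L ≠ Set.univ ∧ HasLinearRecessionCone L then
    sInf {k : ℕ∞ | ∃ m : ℕ, 1 ≤ m ∧ HasWidthRepresentation L m ∧ k = (m : ℕ∞)}
  else ⊤

/-- `m(𝓛)`, the supremum of `m(L)` over all members `L` of the family `𝓛`. -/
noncomputable def familyMaxFacetWidth {d : ℕ} (𝓛 : Set (Set (Fin d → ℝ))) : ℕ∞ :=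
  ⨆ L ∈ 𝓛, maxFacetWidth L

/-- `X` and `Y` are `ℤ^d`-equivalent: `Y = U X + b` for a unimodular matrix `U` (an integer
matrix of determinant `1` or `-1`) and an integer vector `b`. -/
def IntEquivalent {d : ℕ} (X Y : Set (Fin d → ℝ)) : Prop :=
  ∃ (U : Matrix (Fin d) (Fin d) ℤ) (b : Fin d → ℤ),
    (U.det = 1 ∨ U.det = -1) ∧
      Y = (fun x : Fin d → ℝ =>
        Matrix.mulVec (U.map (fun z : ℤ => (z : ℝ))) x + fun j => (b j : ℝ)) '' X

/-- The family `𝓧` is finite up to `ℤ^d`-equivalence: there are finitely many subsets of `ℝ^d`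
such that each member of `𝓧` is `ℤ^d`-equivalent to one of them. -/
def FiniteUpToIntEquivalence {d : ℕ} (𝓧 : Set (Set (Fin d → ℝ))) : Prop :=
  ∃ F : Set (Set (Fin d → ℝ)), F.Finite ∧ ∀ X ∈ 𝓧, ∃ Y ∈ F, IntEquivalent X Y

/-!
For the implication from finiteness up to `ℤ^d`-equivalence to a bounded max-facet-width it suffices
that every single `m(L)` is finite, because having a width representation with a given `m` is
invariant under `ℤ^d`-equivalence. Finiteness of `m(L)` rests on two facts. The recession cone of a
maximal lattice-free set is a linear space (`IsMaximalLatticeFree.hasLinearRecessionCone`): given a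
recession direction `u`, simultaneous Diophantine approximation shows that adding the line `ℝ u`
keeps the set lattice-free. And when the recession cone of a nonempty polyhedron is linear, each
functional in its inequality description is bounded below on it
(`exists_lower_bound_of_hasLinearRecessionCone`).

Conversely, let all members have width representations with the same `m`. In a member `L` choose
integer points `p, p + q₁, …, p + q_d` with `q₁, …, q_d` linearly independent. A row
`b - m ≤ ⟨a, x⟩ ≤ b` is determined by the integers `⟨a, q_k⟩ ∈ [-m, m]` and `b - ⟨a, p⟩ ∈ [0, m]`,
so the rows can be indexed by a finite type `D` depending only on `d` and `m`
(`HasWidthRepresentation.exists_rowData`), and `L` is described by a matrix `A : D × d`, bounded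
right-hand sides `β` and the base point `p`. The lattice `A ℤ^d ⊆ ℤ^D` contains the lattice generated
by the bounded vectors `A q_k` and is contained in its saturation, so only finitely many lattices
occur (`Matrix.finite_setOf_range_mulVecLin`). Finally `β` and `A ℤ^d` determine `L` up to
`ℤ^d`-equivalence, since two matrices with the same column lattice and equally many columns differ
by a unimodular factor (`Matrix.exists_unimodular_of_range_mulVecLin_eq`). This treats bounded and
unbounded members alike, and uses maximality only in the first implication.
-/

open Topology Filter

/-! ### Recession cones of maximal lattice-free sets -/

lemma affineSpan_eq_top_of_affineDim {d : ℕ} (hd : 1 ≤ d) {X : Set (Fin d → ℝ)}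
    (h : affineDim X = d) : affineSpan ℝ X = ⊤ ∧ X.Nonempty := by
  have hne : X.Nonempty := by
    by_contra hX
    rw [Set.not_nonempty_iff_eq_empty] at hX
    subst hX
    rw [affineDim, AffineSubspace.span_empty, AffineSubspace.direction_bot, finrank_bot] at h
    omega
  refine ⟨?_, hne⟩
  rw [← AffineSubspace.direction_eq_top_iff_of_nonempty (hne.affineSpan ℝ)]
  apply Submodule.eq_top_of_finrank_eq
  simpa [affineDim] using h

/-- Simultaneous Dirichlet approximation, in the qualitative form obtained from compactness of the
unit cube: arbitrarily large multiples of `u` come arbitrarily close to the integer lattice. -/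
lemma exists_mul_near_intLattice {d : ℕ} (u : Fin d → ℝ) (T : ℝ) {ε : ℝ} (hε : 0 < ε) :
    ∃ t : ℝ, T ≤ t ∧ ∃ p : Fin d → ℤ, dist (fun j => (p j : ℝ)) (t • u) < ε := by
  obtain ⟨N, hN⟩ := exists_nat_ge T
  let x : ℕ → Fin d → ℝ := fun n j => Int.fract ((n * (N + 1) : ℝ) * u j)
  have hx : ∀ n, x n ∈ Set.Icc (0 : Fin d → ℝ) 1 := fun n =>
    ⟨fun j => Int.fract_nonneg _, fun j => (Int.fract_lt_one _).le⟩
  obtain ⟨a, -, φ, hφ, ha⟩ := isCompact_Icc.tendsto_subseq hx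
  obtain ⟨K, hK⟩ := Metric.cauchySeq_iff'.1 ha.cauchySeq ε hε
  have h1 := hK (K + 1) (Nat.le_succ K)
  have hlt : φ K + 1 ≤ φ (K + 1) := hφ (Nat.lt_succ_self K)
  have hlt' : (φ K : ℝ) + 1 ≤ φ (K + 1) := by exact_mod_cast hlt
  refine ⟨((φ (K + 1) : ℝ) - φ K) * (N + 1), ?_,
    fun j => ⌊(φ (K + 1) * (N + 1) : ℝ) * u j⌋ - ⌊(φ K * (N + 1) : ℝ) * u j⌋, ?_⟩
  · nlinarith [(Nat.cast_nonneg N : (0 : ℝ) ≤ N)]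
  · rw [dist_comm]
    refine lt_of_eq_of_lt ?_ h1
    rw [dist_eq_norm, dist_eq_norm]
    congr 1
    ext j
    simp only [x, Function.comp, Pi.sub_apply, Pi.smul_apply, smul_eq_mul, Int.fract]
    push_cast
    ring

namespace IsMaximalLatticeFree

variable {d : ℕ} {L : Set (Fin d → ℝ)}

lemma interior_nonempty (hd : 1 ≤ d) (hL : IsMaximalLatticeFree L) : (interior L).Nonempty :=
  hL.prop.convex.interior_nonempty_iff_affineSpan_eq_top.2
    (affineSpan_eq_top_of_affineDim hd hL.prop.dim_eq).1

lemma ne_univ (hL : IsMaximalLatticeFree L) : L ≠ Set.univ := by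
  rintro rfl
  have h : (0 : Fin d → ℝ) ∈ interior Set.univ ∩ intLattice d :=
    ⟨by simp, fun j => ⟨0, by simp⟩⟩
  rw [hL.prop.interior_inter] at h
  exact h

/-- If `u` is a recession direction of `L`, then the closure of `interior L + ℝ u` is still
lattice-free, because an integer point `z` in it could be moved, along an integer vector close to a
large multiple of `u`, into the interior of `L`. Maximality then gives `-u` as a recession
direction. -/
lemma neg_mem_recessionCone (hd : 1 ≤ d) (hL : IsMaximalLatticeFree L) {u : Fin d → ℝ}
    (hu : u ∈ recessionCone L) : -u ∈ recessionCone L := by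
  have hint := hL.interior_nonempty hd
  have hconv := hL.prop.convex
  have hcl : closure (interior L) = L := by
    rw [hconv.closure_interior_eq_closure_of_nonempty_interior hint,
      hL.prop.isClosed.closure_eq]
  let C : Set (Fin d → ℝ) := {x | ∃ t : ℝ, x + t • u ∈ interior L}
  have hCopen : IsOpen C := by
    have : C = ⋃ t : ℝ, (fun x => x + t • u) ⁻¹' interior L := by ext; simp [C]
    rw [this]
    exact isOpen_iUnion fun t => isOpen_interior.preimage (by fun_prop)
  have hCconv : Convex ℝ C := by
    rintro x ⟨s, hs⟩ y ⟨t, ht⟩ a b ha hb hab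
    refine ⟨a * s + b * t, ?_⟩
    have := hconv.interior hs ht ha hb hab
    convert this using 1
    module
  have hLC : interior L ⊆ C := fun x hx => ⟨0, by simpa using hx⟩
  have hLK : L ⊆ closure C := by
    rw [← hcl]
    exact closure_mono hLC
  have hK : IsLatticeFree (closure C) := by
    refine ⟨?_, isClosed_closure, hCconv.closure, ?_⟩
    · have : affineSpan ℝ (closure C) = ⊤ :=
        top_unique ((affineSpan_eq_top_of_affineDim hd hL.prop.dim_eq).1 ▸ affineSpan_mono ℝ hLK)
      rw [affineDim, this, AffineSubspace.direction_top, finrank_top, Module.finrank_fin_fun]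
    · rw [hCconv.interior_closure_eq_interior_of_nonempty_interior
        (by rw [hCopen.interior_eq]; exact hint.mono hLC), hCopen.interior_eq,
        Set.eq_empty_iff_forall_notMem]
      rintro z ⟨⟨t, ht⟩, hz⟩
      obtain ⟨ε, hε, hball⟩ := Metric.isOpen_iff.1 isOpen_interior _ ht
      obtain ⟨s, hs, p, hp⟩ := exists_mul_near_intLattice u t hε
      have hsub : Metric.ball (z + s • u) ε ⊆ L := by
        intro y hy
        have : y - (s - t) • u ∈ L := by
          refine interior_subset (hball ?_)
          rw [Metric.mem_ball, dist_eq_norm] at hy ⊢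
          convert hy using 2
          module
        simpa using hu _ this (s - t) (by linarith)
      have hmem : z + (fun j => (p j : ℝ)) ∈ interior L := by
        refine interior_maximal hsub Metric.isOpen_ball ?_
        rw [Metric.mem_ball, dist_add_left]
        exact hp
      have : z + (fun j => (p j : ℝ)) ∈ interior L ∩ intLattice d := by
        refine ⟨hmem, fun j => ?_⟩
        obtain ⟨w, hw⟩ := hz j
        exact ⟨w + p j, by simp [hw]⟩
      rw [hL.prop.interior_inter] at this
      exact this
  have hKL : closure C ⊆ L := hL.2 hK hLK
  intro x hx t _
  rw [← hcl] at hx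
  refine hKL (map_mem_closure (f := fun y => y + t • -u) (by fun_prop) hx fun y hy => ⟨t, ?_⟩)
  simpa using hy

lemma hasLinearRecessionCone (hd : 1 ≤ d) (hL : IsMaximalLatticeFree L) :
    HasLinearRecessionCone L := by
  refine ⟨{ carrier := recessionCone L, add_mem' := ?_, zero_mem' := ?_, smul_mem' := ?_ }, rfl⟩
  · intro u v hu hv x hx t ht
    simpa [add_assoc] using hv _ (hu x hx t ht) t ht
  · intro x hx t _
    simpa using hx
  · intro c u hu x hx t ht
    rcases le_total 0 c with hc | hc
    · simpa [smul_smul] using hu x hx (t * c) (by positivity)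
    · have := hL.neg_mem_recessionCone hd hu x hx (t * -c) (mul_nonneg ht (by linarith))
      simpa [smul_smul] using this

end IsMaximalLatticeFree

/-! ### The scalar product with an integer vector -/

section intInner

variable {d : ℕ}

lemma intInner_add (a : Fin d → ℤ) (x y : Fin d → ℝ) :
    intInner a (x + y) = intInner a x + intInner a y := by
  simp [intInner, mul_add, Finset.sum_add_distrib]

lemma intInner_smul (a : Fin d → ℤ) (t : ℝ) (x : Fin d → ℝ) :
    intInner a (t • x) = t * intInner a x := by
  simp [intInner, Finset.mul_sum, mul_left_comm]

lemma intInner_neg_left (a : Fin d → ℤ) (x : Fin d → ℝ) : intInner (-a) x = -intInner a x := by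
  simp [intInner]

lemma intInner_neg_right (a : Fin d → ℤ) (x : Fin d → ℝ) : intInner a (-x) = -intInner a x := by
  simp [intInner]

lemma intInner_sub (a : Fin d → ℤ) (x y : Fin d → ℝ) :
    intInner a (x - y) = intInner a x - intInner a y := by
  rw [sub_eq_add_neg, intInner_add, intInner_neg_right, sub_eq_add_neg]

lemma intInner_intCast (a x : Fin d → ℤ) :
    intInner a (fun j => (x j : ℝ)) = ((a ⬝ᵥ x : ℤ) : ℝ) := by
  simp [intInner, dotProduct]

lemma intInner_vecMul (a : Fin d → ℤ) (U : Matrix (Fin d) (Fin d) ℤ) (x : Fin d → ℝ) :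
    intInner (Matrix.vecMul a U) x
      = intInner a (Matrix.mulVec (U.map (fun z : ℤ => (z : ℝ))) x) := by
  have h : ∀ (c : Fin d → ℤ) y, intInner c y = (fun j => (c j : ℝ)) ⬝ᵥ y := fun _ _ => rfl
  rw [h, h, Matrix.dotProduct_mulVec]
  congr 1
  ext j
  simp [Matrix.vecMul, dotProduct]

end intInner

/-! ### Width representations of rational polyhedra -/

/-- A rational polyhedron can be described by integer data. -/
lemma IsRationalPolyhedron.exists_int {d : ℕ} {L : Set (Fin d → ℝ)}
    (hL : IsRationalPolyhedron L) :
    ∃ (n : ℕ) (a : Fin n → Fin d → ℤ) (b : Fin n → ℤ), L = {x | ∀ i, intInner (a i) x ≤ b i} := by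
  obtain ⟨n, a, b, rfl⟩ := hL
  obtain ⟨N, hN⟩ := IsLocalization.exist_integer_multiples_of_finite (nonZeroDivisors ℤ)
    (fun p : Fin n × Option (Fin d) => p.2.elim (b p.1) (a p.1))
  -- Squaring the common denominator makes it positive.
  have key : ∀ q : ℚ, IsLocalization.IsInteger ℤ ((N : ℤ) • q) →
      ∃ z : ℤ, (z : ℝ) = ((N : ℤ) : ℝ) ^ 2 * q := by
    rintro q ⟨z, hz⟩
    refine ⟨N * z, ?_⟩
    have hz' : (z : ℚ) = (N : ℤ) * q := by simpa using hz
    have hz'' : (z : ℝ) = ((N : ℤ) : ℝ) * q := by exact_mod_cast congrArg (Rat.cast : ℚ → ℝ) hz'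
    push_cast
    rw [hz'']
    ring
  have hpos : (0 : ℝ) < ((N : ℤ) : ℝ) ^ 2 := by
    have : ((N : ℤ) : ℝ) ≠ 0 := by exact_mod_cast nonZeroDivisors.ne_zero N.2
    positivity
  choose a' ha' using fun i j => key (a i j) (hN (i, some j))
  choose b' hb' using fun i => key (b i) (hN (i, none))
  refine ⟨n, a', b', ?_⟩
  ext x
  refine forall_congr' fun i => ?_
  have : intInner (a' i) x = ((N : ℤ) : ℝ) ^ 2 * ∑ j, (a i j : ℝ) * x j := by
    simp [intInner, ha', Finset.mul_sum, mul_assoc]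
  rw [this, hb', mul_le_mul_iff_right₀ hpos]

/-- If the recession cone of a nonempty polyhedron is a linear space, then the functionals of its
inequality description are bounded below on it. Otherwise a limit of normalized value vectors of
points of the polyhedron would be the value vector of a recession direction `u` with `-u` not a
recession direction. -/
lemma exists_lower_bound_of_hasLinearRecessionCone {d n : ℕ} {a : Fin n → Fin d → ℤ}
    {b : Fin n → ℤ} (hne : {x | ∀ i, intInner (a i) x ≤ b i}.Nonempty)
    (hrec : HasLinearRecessionCone {x | ∀ i, intInner (a i) x ≤ b i}) :
    ∃ m : ℕ, 1 ≤ m ∧ ∀ x ∈ {x | ∀ i, intInner (a i) x ≤ b i}, ∀ i,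
      (b i : ℝ) - m ≤ intInner (a i) x := by
  obtain ⟨S, hS⟩ := hrec
  set L := {x | ∀ i, intInner (a i) x ≤ b i} with hLdef
  let A : (Fin d → ℝ) →ₗ[ℝ] (Fin n → ℝ) :=
    { toFun := fun x i => intInner (a i) x
      map_add' := fun x y => funext fun i => intInner_add _ _ _
      map_smul' := fun t x => funext fun i => intInner_smul _ _ _ }
  have hA : ∀ x i, A x i = intInner (a i) x := fun _ _ => rfl
  -- Since the recession cone is linear, all functionals vanish on it.
  have hzero : ∀ u, (∀ i, A u i ≤ 0) → A u = 0 := by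
    intro u hu
    have hmem : u ∈ S := by
      rw [← SetLike.mem_coe, hS]
      intro x hx t ht i
      rw [intInner_add, intInner_smul]
      have := hx i
      have := mul_nonpos_of_nonneg_of_nonpos ht (hu i)
      rw [hA] at this
      linarith
    have hneg : -u ∈ recessionCone L := by
      rw [← hS]
      exact S.neg_mem hmem
    obtain ⟨x, hx⟩ := hne
    ext i
    refine le_antisymm (hu i) ?_
    by_contra hlt
    rw [not_le, Pi.zero_apply] at hlt
    have h0 : 0 < -A u i := by linarith
    have hxi : A x i ≤ b i := hx i
    have := hneg x hx ((b i - A x i + 1) / -A u i) (div_nonneg (by linarith) h0.le) i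
    rw [intInner_add, intInner_smul, intInner_neg_right, ← hA, ← hA,
      div_mul_cancel₀ _ h0.ne'] at this
    linarith
  by_contra! hcon
  choose x hx i hi using fun k : ℕ => hcon (k + 1) (by omega)
  have hb : ∃ B : ℝ, ∀ i, |(b i : ℝ)| ≤ B :=
    ⟨∑ i, |(b i : ℝ)|, fun i => Finset.single_le_sum (f := fun i => |(b i : ℝ)|)
      (fun _ _ => abs_nonneg _) (Finset.mem_univ i)⟩
  obtain ⟨B, hB⟩ := hb
  have hnorm : Tendsto (fun k => ‖A (x k)‖) atTop atTop := by
    refine tendsto_atTop_mono (f := fun k : ℕ => (k : ℝ) + (1 - B)) (fun k => ?_)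
      (tendsto_atTop_add_const_right _ _ tendsto_natCast_atTop_atTop)
    have h1 := norm_le_pi_norm (A (x k)) (i k)
    have h2 := hi k
    have h3 := (abs_le.1 (hB (i k))).2
    rw [Real.norm_eq_abs, hA] at h1
    have h4 := neg_abs_le (intInner (a (i k)) (x k))
    push_cast at h2
    linarith
  have hpos : ∀ᶠ k in atTop, 0 < ‖A (x k)‖ := hnorm.eventually_gt_atTop 0
  have hmem : ∃ᶠ k in atTop,
      ‖A (x k)‖⁻¹ • A (x k) ∈ Metric.sphere (0 : Fin n → ℝ) 1 := by
    refine (hpos.mono fun k hk => ?_).frequently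
    rw [mem_sphere_zero_iff_norm, norm_smul, norm_inv, norm_norm, inv_mul_cancel₀ hk.ne']
  obtain ⟨v, hv, φ, hφ, hlim⟩ := (isCompact_sphere (0 : Fin n → ℝ) 1).tendsto_subseq' hmem
  have hvA : v ∈ LinearMap.range A :=
    (LinearMap.range A).closed_of_finiteDimensional.mem_of_tendsto hlim
      (Eventually.of_forall fun k => Submodule.smul_mem _ _ (LinearMap.mem_range_self _ _))
  obtain ⟨u, rfl⟩ := hvA
  have hu : A u = 0 := by
    refine hzero u fun j => ?_
    have h1 : Tendsto (fun k => ‖A (x (φ k))‖⁻¹ * (b j : ℝ)) atTop (𝓝 0) := by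
      simpa using ((tendsto_inv_atTop_zero.comp hnorm).comp hφ.tendsto_atTop).mul_const (b j : ℝ)
    refine le_of_tendsto_of_tendsto' ((tendsto_pi_nhds.1 hlim) j) h1 fun k => ?_
    exact mul_le_mul_of_nonneg_left (hx (φ k) j) (by positivity)
  rw [hu, mem_sphere_zero_iff_norm, norm_zero] at hv
  exact zero_ne_one hv

lemma IsRationalPolyhedron.exists_hasWidthRepresentation {d : ℕ} {L : Set (Fin d → ℝ)}
    (hL : IsRationalPolyhedron L) (hne : L.Nonempty) (huniv : L ≠ Set.univ)
    (hrec : HasLinearRecessionCone L) : ∃ m : ℕ, 1 ≤ m ∧ HasWidthRepresentation L m := by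
  obtain ⟨n, a, b, rfl⟩ := hL.exists_int
  obtain ⟨m, hm, hlow⟩ := exists_lower_bound_of_hasLinearRecessionCone hne hrec
  obtain ⟨x₀, hx₀⟩ := hne
  have hzero : ∀ i, a i = 0 → ∀ x, intInner (a i) x ≤ b i := by
    intro i hi x
    have := hx₀ i
    simp only [hi, intInner, Pi.zero_apply, Int.cast_zero, zero_mul, Finset.sum_const_zero]
      at this ⊢
    exact this
  obtain ⟨i₀, hi₀⟩ : ∃ i, a i ≠ 0 := by
    by_contra! h
    exact huniv (Set.eq_univ_of_forall fun x i => hzero i (h i) x)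
  -- Trivial inequalities are replaced by a copy of a nontrivial one.
  let σ : Fin n → Fin n := fun i => if a i = 0 then i₀ else i
  have hσ : ∀ i, a i ≠ 0 → σ i = i := fun i hi => if_neg hi
  refine ⟨m, hm, n, fun i => a (σ i), fun i => b (σ i), Fin.pos i₀, fun i => ?_, ?_⟩
  · by_cases hi : a i = 0
    · simpa [σ, hi] using hi₀
    · simpa [hσ i hi] using hi
  · ext x
    refine ⟨fun hx i => ⟨hlow x hx _, hx _⟩, fun hx i => ?_⟩
    by_cases hi : a i = 0
    · exact hzero i hi x
    · simpa [hσ i hi] using (hx i).2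

lemma HasWidthRepresentation.mono {d : ℕ} {L : Set (Fin d → ℝ)} {k m : ℕ} (hkm : k ≤ m)
    (h : HasWidthRepresentation L k) : HasWidthRepresentation L m := by
  obtain ⟨n, a, b, hn, ha, rfl⟩ := h
  -- The slab `b - k ≤ ⟨a, x⟩ ≤ b` is the intersection of two slabs of width `m`.
  refine ⟨n + n, Fin.append a fun i => -a i, Fin.append b fun i => k - b i, by omega, ?_, ?_⟩
  · intro i
    refine Fin.addCases (fun i => ?_) (fun i => ?_) i
    · rw [Fin.append_left]
      exact ha i
    · rw [Fin.append_right]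
      exact neg_ne_zero.2 (ha i)
  · ext x
    have hkm' : (k : ℝ) ≤ m := by exact_mod_cast hkm
    simp only [Set.mem_ofPred_eq]
    constructor
    · intro hx i
      refine Fin.addCases (fun i => ?_) (fun i => ?_) i <;> obtain ⟨h1, h2⟩ := hx i
      · simp only [Fin.append_left]
        constructor <;> linarith
      · simp only [Fin.append_right, intInner_neg_left]
        push_cast
        constructor <;> linarith
    · intro hx i
      have h1 := (hx (Fin.castAdd n i)).2
      have h2 := (hx (Fin.natAdd n i)).2
      simp only [Fin.append_left, Fin.append_right, intInner_neg_left] at h1 h2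
      push_cast at h2
      constructor <;> linarith

section maxFacetWidth

variable {d : ℕ} {L : Set (Fin d → ℝ)}

lemma HasWidthRepresentation.of_maxFacetWidth_le {M : ℕ} (h : maxFacetWidth L ≤ M) :
    HasWidthRepresentation L M := by
  classical
  rw [maxFacetWidth] at h
  split_ifs at h with hL
  · have hlt := h.trans_lt (ENat.natCast_lt_natCast.2 (Nat.lt_succ_self M))
    obtain ⟨_, ⟨m, -, hm, rfl⟩, hmM⟩ := sInf_lt_iff.1 hlt
    exact hm.mono (Nat.lt_succ_iff.1 (ENat.natCast_lt_natCast.1 hmM))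
  · exact absurd h (by simp)

lemma maxFacetWidth_le {m : ℕ} (huniv : L ≠ Set.univ) (hrec : HasLinearRecessionCone L)
    (hm : 1 ≤ m) (h : HasWidthRepresentation L m) : maxFacetWidth L ≤ m := by
  classical
  rw [maxFacetWidth, if_pos ⟨huniv, hrec⟩]
  exact sInf_le ⟨m, hm, h, rfl⟩

end maxFacetWidth

/-! ### Invariance under `ℤ^d`-equivalence -/

/-- `ℤ^d`-equivalence expressed through preimages instead of images. -/
lemma intEquivalent_iff_preimage {d : ℕ} {X Y : Set (Fin d → ℝ)} :
    IntEquivalent X Y ↔ ∃ (U : Matrix (Fin d) (Fin d) ℤ) (b : Fin d → ℤ),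
      (U.det = 1 ∨ U.det = -1) ∧
        X = {x | Matrix.mulVec (U.map (fun z : ℤ => (z : ℝ))) x + (fun j => (b j : ℝ)) ∈ Y} := by
  refine exists_congr fun U => exists_congr fun b => and_congr_right fun hU => ?_
  have hdet : IsUnit (U.map (fun z : ℤ => (z : ℝ))) := by
    rw [Matrix.isUnit_iff_isUnit_det]
    have : (U.map (fun z : ℤ => (z : ℝ))).det = ((U.det : ℤ) : ℝ) :=
      ((Int.castRingHom ℝ).map_det U).symm
    rw [this]
    rcases hU with h | h <;> simp [h]
  have hbij : Function.Bijective (fun x : Fin d → ℝ =>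
      Matrix.mulVec (U.map (fun z : ℤ => (z : ℝ))) x + fun j => (b j : ℝ)) :=
    (Equiv.addRight _).bijective.comp
      ⟨Matrix.mulVec_injective_iff_isUnit.2 hdet, Matrix.mulVec_surjective_iff_isUnit.2 hdet⟩
  constructor
  · rintro rfl
    exact (Set.preimage_image_eq X hbij.1).symm
  · rintro rfl
    exact (Set.image_preimage_eq Y hbij.2).symm

lemma IntEquivalent.symm {d : ℕ} {X Y : Set (Fin d → ℝ)} (h : IntEquivalent X Y) :
    IntEquivalent Y X := by
  rw [intEquivalent_iff_preimage]
  obtain ⟨U, b, hU, rfl⟩ := h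
  have hu : IsUnit U.det := Int.isUnit_iff.2 hU
  have hUV : U * U⁻¹ = 1 := Matrix.mul_nonsing_inv U hu
  have hVU : U⁻¹ * U = 1 := Matrix.nonsing_inv_mul U hu
  have hreal : ∀ {V W : Matrix (Fin d) (Fin d) ℤ}, V * W = 1 →
      V.map (fun z : ℤ => (z : ℝ)) * W.map (fun z : ℤ => (z : ℝ)) = 1 := by
    intro V W h
    have := congrArg (Int.castRingHom ℝ).mapMatrix h
    rwa [map_mul, map_one] at this
  have hcast : ∀ (V : Matrix (Fin d) (Fin d) ℤ) (c : Fin d → ℤ),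
      (fun j => ((V.mulVec c j : ℤ) : ℝ))
        = (V.map (fun z : ℤ => (z : ℝ))).mulVec (fun j => (c j : ℝ)) := by
    intro V c
    ext j
    simp [Matrix.mulVec, dotProduct]
  refine ⟨U⁻¹, U⁻¹.mulVec (-b), ?_, ?_⟩
  · exact Int.isUnit_iff.1 (Matrix.isUnit_nonsing_inv_det U hu)
  · have hb : (fun j => (((-b) j : ℤ) : ℝ)) = -fun j => (b j : ℝ) := by ext; simp
    ext y
    rw [Set.mem_ofPred_eq, hcast, ← Matrix.mulVec_add, hb]
    constructor
    · rintro ⟨x, hx, rfl⟩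
      simpa [Matrix.mulVec_mulVec, hreal hVU] using hx
    · intro hy
      refine ⟨_, hy, ?_⟩
      simp [Matrix.mulVec_mulVec, hreal hUV]

lemma IntEquivalent.hasWidthRepresentation {d m : ℕ} {X Y : Set (Fin d → ℝ)}
    (h : IntEquivalent X Y) (hY : HasWidthRepresentation Y m) : HasWidthRepresentation X m := by
  obtain ⟨U, t, hU, rfl⟩ := intEquivalent_iff_preimage.1 h
  obtain ⟨n, a, b, hn, ha, rfl⟩ := hY
  have hdet : U.det ≠ 0 := by rcases hU with h | h <;> simp [h]
  refine ⟨n, fun i => Matrix.vecMul (a i) U, fun i => b i - a i ⬝ᵥ t, hn,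
    fun i hi => ha i (Matrix.eq_zero_of_vecMul_eq_zero hdet hi), ?_⟩
  ext x
  refine forall_congr' fun i => ?_
  rw [intInner_vecMul, intInner_add, intInner_intCast]
  push_cast
  constructor <;> rintro ⟨h1, h2⟩ <;> constructor <;> linarith

/-! ### Lattices generated by the columns of an integer matrix -/

/-- Two homomorphisms out of the same free module of finite rank over a principal ideal domain
that have the same free image differ by an automorphism: both split, and their kernels are free of
the same rank. -/
lemma exists_linearEquiv_comp_of_range_eq {R M N : Type*} [CommRing R] [IsDomain R]
    [IsPrincipalIdealRing R] [AddCommGroup M] [Module R M] [Module.Free R M] [Module.Finite R M]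
    [AddCommGroup N] [Module R N] [Module.Free R N]
    {f g : M →ₗ[R] N} (h : LinearMap.range f = LinearMap.range g) :
    ∃ e : M ≃ₗ[R] M, ∀ x, g x = f (e x) := by
  have hker : Module.finrank R (LinearMap.ker f) = Module.finrank R (LinearMap.ker g) := by
    have h1 := Submodule.finrank_quotient_add_finrank (LinearMap.ker f)
    have h2 := Submodule.finrank_quotient_add_finrank (LinearMap.ker g)
    rw [f.quotKerEquivRange.finrank_eq] at h1
    rw [g.quotKerEquivRange.finrank_eq, ← h] at h2
    omega
  let κ : LinearMap.ker g ≃ₗ[R] LinearMap.ker f := LinearEquiv.ofFinrankEq _ _ hker.symm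
  obtain ⟨s, hs⟩ := Module.projective_lifting_property f.rangeRestrict
    (LinearMap.id : LinearMap.range f →ₗ[R] LinearMap.range f) f.surjective_rangeRestrict
  obtain ⟨t, ht⟩ := Module.projective_lifting_property g.rangeRestrict
    (LinearMap.id : LinearMap.range g →ₗ[R] LinearMap.range g) g.surjective_rangeRestrict
  have hs' : ∀ y, f (s y) = y := fun y => congrArg Subtype.val (LinearMap.congr_fun hs y)
  have ht' : ∀ y, g (t y) = y := fun y => congrArg Subtype.val (LinearMap.congr_fun ht y)
  let ι : LinearMap.range g →ₗ[R] LinearMap.range f := Submodule.inclusion h.ge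
  let π : M →ₗ[R] LinearMap.ker g :=
    (LinearMap.id - t ∘ₗ g.rangeRestrict).codRestrict _ fun x => by simp [ht']
  let e : M →ₗ[R] M :=
    s ∘ₗ ι ∘ₗ g.rangeRestrict + (LinearMap.ker f).subtype ∘ₗ κ.toLinearMap ∘ₗ π
  have he : ∀ x, e x = s (ι (g.rangeRestrict x)) + κ (π x) := fun x => rfl
  have hπ : ∀ x, (π x : M) = x - t (g.rangeRestrict x) := fun x => rfl
  have hfe : ∀ x, f (e x) = g x := by
    intro x
    rw [he, map_add, hs', LinearMap.mem_ker.1 (κ (π x)).2, add_zero]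
    rfl
  refine ⟨LinearEquiv.ofBijective e ⟨?_, ?_⟩, fun x => (hfe x).symm⟩
  · rw [← LinearMap.ker_eq_bot, LinearMap.ker_eq_bot']
    intro x hx
    have hgx : g.rangeRestrict x = 0 := Subtype.ext (by simpa [hx] using (hfe x).symm)
    rw [he, hgx, map_zero, map_zero, zero_add] at hx
    have h0 : π x = 0 := by simpa using hx
    have := hπ x
    rw [h0, hgx, map_zero, sub_zero] at this
    exact this.symm
  · intro y
    let w : LinearMap.ker f := ⟨y - s (f.rangeRestrict y), by simp [hs']⟩
    let v : LinearMap.range g := ⟨f y, h ▸ LinearMap.mem_range_self f y⟩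
    have hg : g.rangeRestrict (t v + κ.symm w) = v := by
      apply Subtype.ext
      change g (t v + κ.symm w) = v
      rw [map_add, ht', LinearMap.mem_ker.1 (κ.symm w).2, add_zero]
    refine ⟨t v + κ.symm w, ?_⟩
    have hp : π (t v + κ.symm w) = κ.symm w := by
      apply Subtype.ext
      rw [hπ, hg]
      simp
    rw [he, hg, hp, LinearEquiv.apply_symm_apply]
    change s (f.rangeRestrict y) + (y - s (f.rangeRestrict y)) = y
    abel

/-- Integer matrices with the same number of columns whose columns generate the same lattice
agree up to a unimodular transformation of the columns. -/
lemma Matrix.exists_unimodular_of_range_mulVecLin_eq {D n : Type*} [Fintype D] [Fintype n]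
    [DecidableEq n] {A B : Matrix D n ℤ}
    (h : LinearMap.range A.mulVecLin = LinearMap.range B.mulVecLin) :
    ∃ U : Matrix n n ℤ, (U.det = 1 ∨ U.det = -1) ∧ B = A * U := by
  obtain ⟨e, he⟩ := exists_linearEquiv_comp_of_range_eq h
  refine ⟨LinearMap.toMatrix' e.toLinearMap, ?_, ?_⟩
  · rw [LinearMap.det_toMatrix']
    exact Int.isUnit_iff.1 e.isUnit_det'
  · refine Matrix.ext_of_mulVec_single fun j => ?_
    rw [← Matrix.mulVec_mulVec, LinearMap.toMatrix'_mulVec]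
    exact he _

/-- A submodule of a finitely generated abelian group has only finitely many overgroups in which
it has torsion quotient. -/
lemma finite_setOf_torsion_overgroups {M : Type*} [AddCommGroup M] [Module.Finite ℤ M]
    (Γ : Submodule ℤ M) :
    {G : Submodule ℤ M | Γ ≤ G ∧ ∀ g ∈ G, ∃ k : ℤ, k ≠ 0 ∧ k • g ∈ Γ}.Finite := by
  let T := Submodule.torsion ℤ (M ⧸ Γ)
  have : Finite T := Module.finite_of_fg_torsion T Submodule.torsion_isTorsion
  have hT : (T : Set (M ⧸ Γ)).Finite := Set.toFinite _
  refine Set.Finite.of_finite_image (f := fun G => (Γ.mkQ '' (G : Set M)))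
    (hT.finite_subsets.subset ?_) ?_
  · rintro _ ⟨G, ⟨-, hG⟩, rfl⟩ _ ⟨g, hg, rfl⟩
    obtain ⟨k, hk, hkg⟩ := hG g hg
    refine (Submodule.mem_torsion_iff _).2 ⟨⟨k, mem_nonZeroDivisors_of_ne_zero hk⟩, ?_⟩
    change k • Γ.mkQ g = 0
    rw [← map_smul]
    exact (Submodule.Quotient.mk_eq_zero Γ).2 hkg
  · intro G hG H hH hGH
    have hGH' : G.map Γ.mkQ = H.map Γ.mkQ := SetLike.coe_injective hGH
    have := congrArg (Submodule.comap Γ.mkQ) hGH'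
    rwa [Submodule.comap_map_mkQ, Submodule.comap_map_mkQ, sup_eq_right.2 hG.1,
      sup_eq_right.2 hH.1] at this

/-- There are finitely many column lattices of integer matrices `A` that become bounded after
multiplication with some nonsingular integer matrix `Q`: the column lattice of `A` lies between
the column lattice of `A * Q`, for which there are finitely many candidates, and its saturation. -/
lemma Matrix.finite_setOf_range_mulVecLin {D n : Type*} [Fintype D] [Fintype n]
    [DecidableEq n] (m : ℤ) :
    {G : Submodule ℤ (D → ℤ) | ∃ (A : Matrix D n ℤ) (Q : Matrix n n ℤ), Q.det ≠ 0 ∧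
      (∀ i j, (A * Q) i j ∈ Set.Icc (-m) m) ∧ LinearMap.range A.mulVecLin = G}.Finite := by
  have hC : {C : Matrix D n ℤ | ∀ i j, C i j ∈ Set.Icc (-m) m}.Finite := by
    have := Set.Finite.pi' fun _ : D => Set.Finite.pi' fun _ : n => Set.finite_Icc (-m) m
    exact this
  refine (hC.biUnion fun C _ =>
    finite_setOf_torsion_overgroups (LinearMap.range C.mulVecLin)).subset ?_
  rintro _ ⟨A, Q, hQ, hAQ, rfl⟩
  refine Set.mem_biUnion (x := A * Q) hAQ ⟨?_, ?_⟩
  · rw [Matrix.mulVecLin_mul]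
    exact LinearMap.range_comp_le_range _ _
  · rintro _ ⟨x, rfl⟩
    refine ⟨Q.det, hQ, Q.adjugate.mulVec x, ?_⟩
    rw [Matrix.mulVecLin_apply, Matrix.mulVecLin_apply, ← Matrix.mulVec_mulVec,
      Matrix.mulVec_mulVec x Q, Matrix.mul_adjugate, Matrix.smul_mulVec, Matrix.one_mulVec,
      Matrix.mulVec_smul]

/-! ### Indexing the rows by a finite type -/

/-- If the integer points of `X` affinely span `ℝ^d`, then differences of integer points of `X`
form the columns of a nonsingular matrix. -/
lemma exists_det_ne_zero_of_affineDim_eq {d : ℕ} (hd : 1 ≤ d) {X : Set (Fin d → ℝ)}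
    (hX : affineDim (convexHull ℝ (X ∩ intLattice d)) = d) :
    ∃ (p : Fin d → ℤ) (Q : Matrix (Fin d) (Fin d) ℤ), Q.det ≠ 0 ∧
      (fun j => (p j : ℝ)) ∈ X ∧ ∀ k, (fun j => ((p j + Q j k : ℤ) : ℝ)) ∈ X := by
  obtain ⟨htop, hne⟩ := affineSpan_eq_top_of_affineDim hd hX
  rw [affineSpan_convexHull] at htop
  obtain ⟨x₀, hx₀⟩ := convexHull_nonempty_iff.1 hne
  have hspan : Submodule.span ℝ ((fun x => x -ᵥ x₀) '' (X ∩ intLattice d)) = ⊤ := by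
    rw [← vectorSpan_eq_span_vsub_set_right ℝ hx₀, ← direction_affineSpan, htop,
      AffineSubspace.direction_top]
  have hrank : Module.finrank ℝ
      (Submodule.span ℝ ((fun x => x -ᵥ x₀) '' (X ∩ intLattice d))) = d := by
    rw [hspan, finrank_top, Module.finrank_fin_fun]
  have hex := Submodule.exists_fun_fin_finrank_span_eq ℝ
    ((fun x => x -ᵥ x₀) '' (X ∩ intLattice d))
  rw [hrank] at hex
  obtain ⟨f, hf, -, hli⟩ := hex
  choose y hy hyf using hf
  choose p hp using hx₀.2
  choose q hq using fun k => (hy k).2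
  have hf' : ∀ k j, f k j = ((q k j - p j : ℤ) : ℝ) := by
    intro k j
    rw [← hyf]
    change y k j - x₀ j = _
    rw [hq, hp, Int.cast_sub]
  refine ⟨p, Matrix.of fun j k => q k j - p j, ?_, ?_, fun k => ?_⟩
  · intro h0
    have hu := (Matrix.isUnit_iff_isUnit_det _).1 (Matrix.linearIndependent_rows_iff_isUnit.1
      (show LinearIndependent ℝ (Matrix.row (Matrix.of f)) from hli))
    have hmap : Matrix.of f
        = ((Int.castRingHom ℝ).mapMatrix (Matrix.of fun j k => q k j - p j)).transpose := by
      ext k j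
      simpa using hf' k j
    rw [hmap, Matrix.det_transpose, ← RingHom.map_det, h0, map_zero] at hu
    exact not_isUnit_zero hu
  · have : (fun j => (p j : ℝ)) = x₀ := funext fun j => (hp j).symm
    exact this ▸ hx₀.1
  · have : (fun j => ((p j + (Matrix.of fun j k => q k j - p j) j k : ℤ) : ℝ)) = y k := by
      ext j
      simp [hq]
    exact this ▸ (hy k).1

/-- The possible data of a row `(a, b)` of a width representation with width `m`, relative to an
integer point `p` of the set and integer vectors `q₁, …, q_d` for which all `p + q_k` lie in the
set: the numbers `⟨a, q_k⟩ ∈ [-m, m]` and `b - ⟨a, p⟩ ∈ [0, m]`. -/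
abbrev RowData (d m : ℕ) : Type :=
  (Fin d → Set.Icc (-(m : ℤ)) m) × Set.Icc (0 : ℤ) m

/-- A set with a width representation and with full-dimensional integer points has a width
representation whose rows are indexed by a finite type depending only on `d` and `m`, because a row
is determined by its data relative to a basis of integer vectors. -/
lemma HasWidthRepresentation.exists_rowData {d m : ℕ} (hd : 1 ≤ d) {L : Set (Fin d → ℝ)}
    (hL : HasWidthRepresentation L m)
    (hdim : affineDim (convexHull ℝ (L ∩ intLattice d)) = d) :
    ∃ (A : Matrix (RowData d m) (Fin d) ℤ) (β : RowData d m → ℤ) (p : Fin d → ℤ)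
      (Q : Matrix (Fin d) (Fin d) ℤ), Q.det ≠ 0 ∧
      (∀ δ k, (A * Q) δ k ∈ Set.Icc (-(m : ℤ)) m) ∧ (∀ δ, β δ ∈ Set.Icc (0 : ℤ) m) ∧
      L = {x | ∀ δ, (β δ : ℝ) - m ≤ intInner (A δ) (x - fun j => (p j : ℝ)) ∧
        intInner (A δ) (x - fun j => (p j : ℝ)) ≤ β δ} := by
  obtain ⟨p, Q, hQ, hp, hpQ⟩ := exists_det_ne_zero_of_affineDim_eq hd hdim
  obtain ⟨n, a, b, hn, -, rfl⟩ := hL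
  have hp' : ∀ i, b i - m ≤ a i ⬝ᵥ p ∧ a i ⬝ᵥ p ≤ b i := by
    intro i
    have := hp i
    rw [intInner_intCast] at this
    exact_mod_cast this
  have hq' : ∀ i k, b i - m ≤ a i ⬝ᵥ p + Matrix.vecMul (a i) Q k ∧
      a i ⬝ᵥ p + Matrix.vecMul (a i) Q k ≤ b i := by
    intro i k
    have := hpQ k i
    rw [intInner_intCast] at this
    have hadd : (a i ⬝ᵥ fun j => p j + Q j k) = a i ⬝ᵥ p + Matrix.vecMul (a i) Q k :=
      dotProduct_add (a i) p fun j => Q j k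
    rw [hadd] at this
    exact_mod_cast this
  have hc : ∀ i k, Matrix.vecMul (a i) Q k ∈ Set.Icc (-(m : ℤ)) m := fun i k => by
    have := hp' i
    have := hq' i k
    constructor <;> omega
  have hβ : ∀ i, b i - a i ⬝ᵥ p ∈ Set.Icc (0 : ℤ) m := fun i => by
    have := hp' i
    constructor <;> omega
  let code : Fin n → RowData d m := fun i =>
    (fun k => ⟨Matrix.vecMul (a i) Q k, hc i k⟩, ⟨b i - a i ⬝ᵥ p, hβ i⟩)
  have hcode : ∀ i i', code i = code i' → a i = a i' ∧ b i = b i' := by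
    intro i i' h
    have ha : a i = a i' := by
      have h0 : Matrix.vecMul (a i - a i') Q = 0 := by
        ext k
        have := congrArg Subtype.val (congrFun (congrArg Prod.fst h) k)
        rw [Matrix.sub_vecMul]
        exact sub_eq_zero.2 this
      exact sub_eq_zero.1 (Matrix.eq_zero_of_vecMul_eq_zero hQ h0)
    refine ⟨ha, ?_⟩
    have hb : b i - a i ⬝ᵥ p = b i' - a i' ⬝ᵥ p := congrArg Subtype.val (congrArg Prod.snd h)
    rw [ha] at hb
    exact sub_left_inj.1 hb
  have : Nonempty (Fin n) := ⟨⟨0, hn⟩⟩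
  let σ : RowData d m → Fin n := Function.invFun code
  have hσ : ∀ i, a (σ (code i)) = a i ∧ b (σ (code i)) = b i := fun i =>
    hcode _ _ (Function.invFun_eq ⟨i, rfl⟩)
  refine ⟨Matrix.of fun δ => a (σ δ), fun δ => b (σ δ) - a (σ δ) ⬝ᵥ p, p, Q, hQ,
    fun δ k => hc (σ δ) k, fun δ => hβ (σ δ), ?_⟩
  have hrow : ∀ i (x : Fin d → ℝ),
      ((((b i - a i ⬝ᵥ p : ℤ) : ℝ) - m ≤ intInner (a i) (x - fun j => (p j : ℝ)) ∧
        intInner (a i) (x - fun j => (p j : ℝ)) ≤ ((b i - a i ⬝ᵥ p : ℤ) : ℝ)) ↔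
      ((b i : ℝ) - m ≤ intInner (a i) x ∧ intInner (a i) x ≤ b i)) := by
    intro i x
    rw [intInner_sub, intInner_intCast]
    push_cast
    constructor <;> rintro ⟨h1, h2⟩ <;> constructor <;> linarith
  ext x
  constructor
  · exact fun hx δ => (hrow (σ δ) x).2 (hx (σ δ))
  · intro hx i
    have := (hrow (σ (code i)) x).1 (hx (code i))
    rwa [(hσ i).1, (hσ i).2] at this

/-! ### Finiteness up to `ℤ^d`-equivalence -/

/-- Two sets given by the same bounds and by matrices with the same column lattice, relative to
integer base points, are `ℤ^d`-equivalent. -/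
lemma intEquivalent_of_range_mulVecLin_eq {d m : ℕ} {D : Type*} [Fintype D]
    {A A' : Matrix D (Fin d) ℤ} {β : D → ℤ} {p p' : Fin d → ℤ}
    (h : LinearMap.range A.mulVecLin = LinearMap.range A'.mulVecLin) :
    IntEquivalent
      {x : Fin d → ℝ | ∀ δ, (β δ : ℝ) - m ≤ intInner (A' δ) (x - fun j => (p' j : ℝ)) ∧
        intInner (A' δ) (x - fun j => (p' j : ℝ)) ≤ β δ}
      {x : Fin d → ℝ | ∀ δ, (β δ : ℝ) - m ≤ intInner (A δ) (x - fun j => (p j : ℝ)) ∧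
        intInner (A δ) (x - fun j => (p j : ℝ)) ≤ β δ} := by
  obtain ⟨U, hU, rfl⟩ := Matrix.exists_unimodular_of_range_mulVecLin_eq h
  rw [intEquivalent_iff_preimage]
  refine ⟨U, p - U.mulVec p', hU, ?_⟩
  ext x
  refine forall_congr' fun δ => ?_
  have hrow : (A * U) δ = Matrix.vecMul (A δ) U := rfl
  have hvec : Matrix.mulVec (U.map (fun z : ℤ => (z : ℝ))) (x - fun j => (p' j : ℝ))
      = Matrix.mulVec (U.map (fun z : ℤ => (z : ℝ))) x
        + (fun j => (((p - U.mulVec p') j : ℤ) : ℝ)) - fun j => (p j : ℝ) := by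
    rw [Matrix.mulVec_sub]
    ext j
    simp only [Matrix.mulVec, dotProduct, Matrix.map_apply, Pi.sub_apply, Pi.add_apply,
      Int.cast_sub, Int.cast_sum, Int.cast_mul]
    ring
  rw [hrow, intInner_vecMul, hvec]

/-- For fixed `m`, the sets with a width representation of width `m` and with full-dimensional
integer points are finitely many up to `ℤ^d`-equivalence. -/
lemma finiteUpToIntEquivalence_of_hasWidthRepresentation {d m : ℕ} (hd : 1 ≤ d)
    {𝓛 : Set (Set (Fin d → ℝ))} (h𝓛 : ∀ L ∈ 𝓛, HasWidthRepresentation L m)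
    (hdim : ∀ L ∈ 𝓛, affineDim (convexHull ℝ (L ∩ intLattice d)) = d) :
    FiniteUpToIntEquivalence 𝓛 := by
  classical
  choose! A β p Q hQ hAQ hβ hL using fun L hL => (h𝓛 L hL).exists_rowData hd (hdim L hL)
  let inv : Set (Fin d → ℝ) → Submodule ℤ (RowData d m → ℤ) × (RowData d m → ℤ) :=
    fun L => (LinearMap.range (A L).mulVecLin, β L)
  have hfin : (inv '' 𝓛).Finite := by
    refine ((Matrix.finite_setOf_range_mulVecLin (D := RowData d m) (n := Fin d) m).prod
      (Set.Finite.pi' fun _ : RowData d m => Set.finite_Icc (0 : ℤ) m)).subset ?_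
    rintro _ ⟨L, h, rfl⟩
    exact ⟨⟨A L, Q L, hQ L h, hAQ L h, rfl⟩, hβ L h⟩
  obtain ⟨F, hF, hbij⟩ := Set.exists_subset_bijOn 𝓛 inv
  refine ⟨F, hbij.finite_iff_finite.2 hfin, fun L h => ?_⟩
  obtain ⟨L', h', he⟩ : inv L ∈ inv '' F := hbij.image_eq ▸ Set.mem_image_of_mem inv h
  refine ⟨L', h', ?_⟩
  have h1 := congrArg Prod.fst he
  have h2 : β L' = β L := congrArg Prod.snd he
  rw [hL L h, hL L' (hF h'), h2]
  exact intEquivalent_of_range_mulVecLin_eq h1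

theorem theorem2 (d : ℕ) (hd : 1 ≤ d) (𝓛 : Set (Set (Fin d → ℝ)))
    (hmax : ∀ L ∈ 𝓛, IsMaximalLatticeFree L)
    (hrat : ∀ L ∈ 𝓛, IsRationalPolyhedron L)
    (hdim : ∀ L ∈ 𝓛, affineDim (convexHull ℝ (L ∩ intLattice d)) = d) :
    familyMaxFacetWidth 𝓛 < ⊤ ↔ FiniteUpToIntEquivalence 𝓛 := by
  constructor
  · intro h
    obtain ⟨M, hM⟩ := ENat.ne_top_iff_exists.1 h.ne
    refine finiteUpToIntEquivalence_of_hasWidthRepresentation (m := M) hd (fun L hL => ?_) hdim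
    refine HasWidthRepresentation.of_maxFacetWidth_le ?_
    rw [hM]
    exact le_iSup₂ (f := fun L (_ : L ∈ 𝓛) => maxFacetWidth L) L hL
  · rintro ⟨F, hF, hequiv⟩
    have hrep : ∀ L ∈ 𝓛, ∃ m : ℕ, 1 ≤ m ∧ HasWidthRepresentation L m := fun L hL =>
      (hrat L hL).exists_hasWidthRepresentation
        (((hmax L hL).interior_nonempty hd).mono interior_subset) (hmax L hL).ne_univ
        ((hmax L hL).hasLinearRecessionCone hd)
    -- A width for which all members of the family equivalent to `Y` have a representation.
    have hY : ∀ Y : Set (Fin d → ℝ), ∃ m : ℕ, 1 ≤ m ∧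
        ∀ L ∈ 𝓛, IntEquivalent L Y → HasWidthRepresentation L m := by
      intro Y
      by_cases hex : ∃ L ∈ 𝓛, IntEquivalent L Y
      · obtain ⟨L, hL, hLY⟩ := hex
        obtain ⟨m, hm, hLm⟩ := hrep L hL
        exact ⟨m, hm, fun L' _ h' => h'.hasWidthRepresentation
          (hLY.symm.hasWidthRepresentation hLm)⟩
      · exact ⟨1, le_rfl, fun L hL h => absurd ⟨L, hL, h⟩ hex⟩
    choose m hm hrepY using hY
    obtain ⟨M, hM⟩ := (hF.image m).bddAbove
    refine lt_of_le_of_lt (iSup₂_le fun L hL => ?_) (ENat.natCast_lt_top M)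
    obtain ⟨Y, hYF, hLY⟩ := hequiv L hL
    calc maxFacetWidth L ≤ (m Y : ℕ∞) :=
          maxFacetWidth_le (hmax L hL).ne_univ ((hmax L hL).hasLinearRecessionCone hd) (hm Y)
            (hrepY Y L hL hLY)
      _ ≤ M := by exact_mod_cast hM (Set.mem_image_of_mem m hYF)
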